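/- **Setting.** Fix real numbers $\theta\neq 0$, $\Omega>0$, $\mu_0$, $M>1$. For $x,y\in\mathbb R^4$ put $x\theta^{-1}y=\frac2\theta(x_1y_2-x_2y_1+x_3y_4-x_4y_3)$. The sliced propagators are, for $u,v\in\mathbb R^4$, $$C^i(u,v)=\int_{I_i}\frac{\Omega\,d\alpha}{[2\pi\sinh\alpha]^2}\,e^{-\frac\Omega4\coth(\frac\alpha2)\|u\|^2-\frac\Omega4\tanh(\frac\alpha2)\|v\|^2-\frac{\mu_0^2}{\Omega}\alpha},$$ where $I_0=[1,\infty)$ and $I_i=[M^{-2i},M^{-2(i-1)}]$ for $i\ge1$. A graph $G$ has $n$ vertices, each bearing four cyclically ordered fields $(v,1),\dots,(v,4)$; some of the fields are joined in disjoint pairs by internal lines (tadpoles and multiple lines are allowed), and the remaining ones are the external fields. A scale assignment $\mu$ gives an integer $i_l\ge0$ to each internal line $l$. Given a test function $\varphi_f$ on $\mathbb R^4$ for each external field $f$, the amputated amplitude is $$A_{G,\mu}=\int\prod_{v,a}dx_{v,a}\prod_v\Big[\delta(x_{v,1}-x_{v,2}+x_{v,3}-x_{v,4})\,e^{i\sum_{a<b}(-1)^{a+b+1}x_{v,a}\theta^{-1}x_{v,b}}\Big]\prod_l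 C^{i_l}(u_l,v_l)\prod_{f\text{ external}}\varphi_f(x_f),$$ where $u_l$ and $v_l$ are the difference and the sum of the positions of the two ends of $l$. For $i\ge 0$ let $G^i_k$, $k=1,\dots,k(i)$, be the connected components of the subgraph formed by the lines of scale at least $i$, and let $N(G^i_k)$ be the number of fields at vertices of $G^i_k$ that are not ends of lines of $G^i_k$. Orient the fields of $G^i_k$ along a spanning tree as entering or exiting, alternately in the cyclic order around each vertex, in such a way that each tree line exits at one end and enters at the other. A line of $G^i_k$ that enters at both ends or exits at both ends is called clashing; $G^i_k$ is orientable if there is no clashing line, and non-orientable otherwise. Let $\omega(G^i_k)=N(G^i_k)-4$ if $G^i_k$ is orientable, and $\omega(G^i_k)=N(G^i_k)$ if it is non-orientable. **Lemma.** Let $\mathcal F$ be a bounded set (for instance a finite set) of Schwartz functions $\mathbb R^4\to\mathbb C$. There is a constant $K>0$, depending only on $\theta,\Omega,\mu_0,M,\mathcal F$, such that for every connected graph $G$ with at least one external field, with $n$ vertices, every scale assignment $\mu$ and every choice of test functions $\varphi_f\in\mathcal F$ for the external fields, the integral defining $A_{G,\mu}$ converges absolutely and $$|A_{G,\mu}|\le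 K^n\prod_{i\ge1}\prod_k M^{-\omega(G^i_k)} .$$ Moreover non-orientable components are irrelevant: $\omega(G^i_k)>0$ whenever $G^i_k$ is non-orientable. -/

import Mathlib

noncomputable section

namespace NCPhi

open MeasureTheory

/-- Four-dimensional Euclidean position space. -/
abbrev Pos : Type := EuclideanSpace ℝ (Fin 4)

/-- The symplectic pairing `x θ⁻¹ y = (2/θ) (x₁ y₂ - x₂ y₁ + x₃ y₄ - x₄ y₃)`. -/
def symp (θ : ℝ) (x y : Pos) : ℝ :=
  2 / θ * (x 0 * y 1 - x 1 * y 0 + x 2 * y 3 - x 3 * y 2)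

/-- The phase `exp (i ∑_{a<b} (-1)^{a+b+1} x_a θ⁻¹ x_b)` of a Moyal vertex; the four corners are
numbered from `0`, which does not change the parity of `a + b`. -/
def vertexPhase (θ : ℝ) (x : Fin 4 → Pos) : ℂ :=
  Complex.exp (Complex.I *
    ((∑ a : Fin 4, ∑ b : Fin 4,
      if a < b then (-1 : ℝ) ^ ((a : ℕ) + (b : ℕ) + 1) * symp θ (x a) (x b) else 0 : ℝ) : ℂ))

/-- The range of the parameter `α` in the slice of scale `i`: `[1, ∞)` for `i = 0` and
`[M^{-2i}, M^{-2(i-1)}]` for `i ≥ 1` (up to end points). -/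
def sliceRange (M : ℝ) : ℕ → Set ℝ
  | 0 => Set.Ioi 1
  | i + 1 => Set.Ioc ((M ^ (2 * (i + 1)))⁻¹) ((M ^ (2 * i))⁻¹)

/-- The propagator `C^i(u, v)` of scale `i` as a function of the short variable `u` and the
long variable `v`. -/
def propagator (Ω μ₀ M : ℝ) (i : ℕ) (u v : Pos) : ℝ :=
  ∫ α in sliceRange M i,
    Ω / (2 * Real.pi * Real.sinh α) ^ 2 *
      Real.exp (-(Ω / 4) * (Real.cosh (α / 2) / Real.sinh (α / 2)) * ‖u‖ ^ 2
        - (Ω / 4) * Real.tanh (α / 2) * ‖v‖ ^ 2 - μ₀ ^ 2 / Ω * α)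

/-- A graph with `n` four-valent vertices and `m` internal lines. A field (half-line) is a pair
`(v, a)` of a vertex and one of its four cyclically ordered corners; each internal line `l` joins
the two fields `src l` and `tgt l`, and no field belongs to two lines. Tadpoles and multiple lines
are allowed. The naming of the two ends is an arbitrary auxiliary choice. -/
structure Graph (n m : ℕ) where
  src : Fin m → Fin n × Fin 4
  tgt : Fin m → Fin n × Fin 4
  inj : Function.Injective (Sum.elim src tgt)

namespace Graph

variable {n m : ℕ} (G : Graph n m)

open Classical in
/-- The fields at the vertices of `W` that are not ends of a line of `S`, that is the external
fields of the subgraph with vertices `W` and lines `S`. -/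
def externalFields (W : Finset (Fin n)) (S : Finset (Fin m)) : Finset (Fin n × Fin 4) :=
  {f | f.1 ∈ W ∧ ∀ l ∈ S, G.src l ≠ f ∧ G.tgt l ≠ f}

/-- The simple graph on the vertices in which two different vertices are adjacent when a line
of `S` joins them. -/
def lineGraph (S : Finset (Fin m)) : SimpleGraph (Fin n) :=
  SimpleGraph.fromRel fun v w => ∃ l ∈ S, (G.src l).1 = v ∧ (G.tgt l).1 = w

/-- The graph is connected (in particular it has a vertex). -/
def Connected : Prop := (G.lineGraph Finset.univ).Connected

/-- `T` is a spanning tree of the subgraph with vertices `W` and lines `S`. -/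
def IsSpanningTree (W : Finset (Fin n)) (S T : Finset (Fin m)) : Prop :=
  T ⊆ S ∧ (∀ v ∈ W, ∀ w ∈ W, (G.lineGraph T).Reachable v w) ∧ T.card + 1 = W.card

/-- An orientation of all fields as entering (`true`) or exiting (`false`), alternating around
each vertex in the cyclic order. -/
def IsAlternating (ε : Fin n × Fin 4 → Bool) : Prop :=
  ∀ v : Fin n, ∀ a : Fin 4, ε (v, a + 1) = !ε (v, a)

/-- A line clashes when it enters at both ends or exits at both ends; otherwise it is
well-oriented. -/
def Clashing (ε : Fin n × Fin 4 → Bool) (l : Fin m) : Prop := ε (G.src l) = ε (G.tgt l)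

/-- The (connected) subgraph with vertices `W` and lines `S` is orientable: orienting the fields
along a spanning tree, so that the orientation alternates around the vertices and every tree line
exits at one end and enters at the other, leaves no clashing line. -/
def Orientable (W : Finset (Fin n)) (S : Finset (Fin m)) : Prop :=
  ∃ T : Finset (Fin m), G.IsSpanningTree W S T ∧
    ∃ ε : Fin n × Fin 4 → Bool, IsAlternating ε ∧ (∀ l ∈ T, ¬ G.Clashing ε l) ∧
      ∀ l ∈ S, ¬ G.Clashing ε l

/-- The lines of scale at least `i`, that is the lines of `G^i`. -/
def highLines (μ : Fin m → ℕ) (i : ℕ) : Finset (Fin m) := {l | i ≤ μ l}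

/-- The index set of the connected components `G^i_k` of `G^i`. A vertex without line in `G^i` is
a component by itself; it has four external fields, is orientable and has `ω = 0`. -/
abbrev Component (μ : Fin m → ℕ) (i : ℕ) : Type :=
  (G.lineGraph (highLines μ i)).ConnectedComponent

section Component

variable {G} {μ : Fin m → ℕ} {i : ℕ}

open Classical in
/-- The vertices of `G^i_k`. -/
def Component.vertices (k : G.Component μ i) : Finset (Fin n) := {v | v ∈ k.supp}

open Classical in
/-- The lines of `G^i_k`. -/
def Component.lines (k : G.Component μ i) : Finset (Fin m) :=
  {l | l ∈ highLines μ i ∧ (G.src l).1 ∈ k.supp}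

/-- `G^i_k` is orientable. -/
def Component.IsOrientable (k : G.Component μ i) : Prop := G.Orientable k.vertices k.lines

/-- The number `N(G^i_k)` of external fields of `G^i_k`. -/
def Component.N (k : G.Component μ i) : ℕ := (G.externalFields k.vertices k.lines).card

open Classical in
/-- The convergence degree: `N - 4` for an orientable component, `N` for a non-orientable one. -/
def Component.omega (k : G.Component μ i) : ℤ :=
  if k.IsOrientable then (k.N : ℤ) - 4 else (k.N : ℤ)

end Component

open Classical in
/-- The product over all scales `i ≥ 1` and all components `G^i_k` of `M^{-ω(G^i_k)}`. Scales above
the largest scale of a line contribute a factor `1`. -/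
def powerCounting (M : ℝ) (μ : Fin m → ℕ) : ℝ :=
  ∏ i ∈ Finset.Icc 1 (Finset.univ.sup μ), ∏ k : G.Component μ i, M ^ (-k.omega)

/-- All positions `x_{v,a}` as functions of the first three positions at each vertex, the last one
being given by `δ(x_{v,1} - x_{v,2} + x_{v,3} - x_{v,4})`. -/
def positions (y : Fin n → Fin 3 → Pos) (v : Fin n) : Fin 4 → Pos :=
  ![y v 0, y v 1, y v 2, y v 0 - y v 1 + y v 2]

/-- The external fields of the whole graph. -/
abbrev externals : Finset (Fin n × Fin 4) := G.externalFields Finset.univ Finset.univ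

/-- The integrand of the amplitude at the positions `x`, without the `δ` functions: vertex
phases, sliced propagators on the internal lines, test functions at the external fields. -/
def integrand (θ Ω μ₀ M : ℝ) (μ : Fin m → ℕ) (φ : Fin n × Fin 4 → SchwartzMap Pos ℂ)
    (x : Fin n → Fin 4 → Pos) : ℂ :=
  (∏ v, vertexPhase θ (x v)) *
  (∏ l, (propagator Ω μ₀ M (μ l)
    (x (G.src l).1 (G.src l).2 - x (G.tgt l).1 (G.tgt l).2)
    (x (G.src l).1 (G.src l).2 + x (G.tgt l).1 (G.tgt l).2) : ℂ)) *
  ∏ f ∈ G.externals, φ f (x f.1 f.2)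

/-- The amputated amplitude `A_{G,μ}` with the external arguments integrated against the test
functions `φ`. The integral of `∏_v δ(x_{v,1} - x_{v,2} + x_{v,3} - x_{v,4}) F(x)` over all
positions is the integral of `F` over the first three positions at each vertex. -/
def amplitude (θ Ω μ₀ M : ℝ) (μ : Fin m → ℕ) (φ : Fin n × Fin 4 → SchwartzMap Pos ℂ) : ℂ :=
  ∫ y : Fin n → Fin 3 → Pos, G.integrand θ Ω μ₀ M μ φ (positions y)

end Graph

end NCPhi

end

/-!
The vertex phases have modulus one, so oscillations play no role. A propagator of scale `i` is at
most a constant times `M ^ (2 * i)` times a Gaussian of width `M ^ (-i)` in its short variable and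
one of width `M ^ i` in its long variable. The integrand is thus dominated by a product of functions
of `4 * n` linear forms (short variables, long variables, external positions) in `3 * n` independent
positions. Integrating over `3 * n` linearly independent forms, and bounding the other factors by
their suprema, costs at most a constant to the power `n`: the forms have integer coefficients, so
the Jacobian is at least one.

Since the graph is connected and has an external field, the short variables are independent. They
are all chosen, then external positions and long variables greedily by increasing scale. A
configuration annihilated by all short variables, all external positions and all long variables
below scale `i` is determined by one value per line of `G^i`, and the vertex constraints put these
values into the kernel of the signed incidence matrix of `G^i`, whose rank is at least `n` minus the
number of orientable components. So at most `L(G^i) - n + #orientable` long variables of scale at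
least `i` are integrated, so scale `i` contributes
`2 L - 4 L + 4 (L - n + #orientable) = - ∑ k, ω(G^i_k)` to the exponent of `M`.
-/

namespace NCPhi

open MeasureTheory

section Propagator

variable {Ω μ₀ M α : ℝ} {i : ℕ}

theorem mul_min_le_tanh_half (hα : 0 < α) :
    (2 * Real.cosh (1 / 2))⁻¹ * min α 1 ≤ Real.tanh (α / 2) := by
  have hcosh := Real.cosh_pos (1 / 2)
  have hcosh_half := Real.cosh_pos (α / 2)
  rw [Real.tanh_eq_sinh_div_cosh]
  rcases le_total α 1 with hα1 | hα1
  · rw [min_eq_left hα1, inv_mul_eq_div, div_le_div_iff₀ (by positivity) hcosh_half]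
    have hsinh : α / 2 ≤ Real.sinh (α / 2) := Real.self_le_sinh_iff.2 (by positivity)
    have hcosh_le : Real.cosh (α / 2) ≤ Real.cosh (1 / 2) := by
      rw [Real.cosh_le_cosh, abs_of_pos (by positivity), abs_of_pos (by positivity)]
      linarith
    nlinarith
  · rw [min_eq_right hα1, mul_one, inv_eq_one_div, div_le_div_iff₀ (by positivity) hcosh_half]
    have hsinh : (1 / 2 : ℝ) ≤ Real.sinh (1 / 2) := Real.self_le_sinh_iff.2 (by positivity)
    have hsinh_sub : 0 ≤ Real.sinh (α / 2 - 1 / 2) := Real.sinh_nonneg_iff.2 (by linarith)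
    rw [Real.sinh_sub] at hsinh_sub
    nlinarith

theorem inv_le_coth_half (hα : 0 < α) : α⁻¹ ≤ Real.cosh (α / 2) / Real.sinh (α / 2) := by
  have hsinh : 0 < Real.sinh (α / 2) := Real.sinh_pos_iff.2 (by positivity)
  rw [inv_eq_one_div, div_le_div_iff₀ hα hsinh, Real.cosh_eq, Real.sinh_eq]
  have hexp_neg : Real.exp (-(α / 2)) = Real.exp (α / 2) * Real.exp (-α) := by
    rw [← Real.exp_add]
    congr 1
    ring
  nlinarith [Real.add_one_le_exp (-α), Real.exp_pos (α / 2), Real.exp_pos (-(α / 2))]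

theorem one_le_coth_half (hα : 0 < α) : 1 ≤ Real.cosh (α / 2) / Real.sinh (α / 2) :=
  (one_le_div (Real.sinh_pos_iff.2 (by positivity))).2 (Real.sinh_lt_cosh _).le

theorem sliceRange_subset_Ioi : sliceRange M i ⊆ Set.Ioi (M ^ (2 * i))⁻¹ := by
  cases i with
  | zero => simp [sliceRange]
  | succ i => exact Set.Ioc_subset_Ioi_self

theorem measurableSet_sliceRange : MeasurableSet (sliceRange M i) := by
  cases i with
  | zero => exact measurableSet_Ioi
  | succ i => exact measurableSet_Ioc

theorem le_coth_half_of_mem_sliceRange (hM : 1 < M) (hα : α ∈ sliceRange M i) :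
    (M ^ 2)⁻¹ * M ^ (2 * i) ≤ Real.cosh (α / 2) / Real.sinh (α / 2) := by
  have hα0 : 0 < α := lt_trans (by positivity) (sliceRange_subset_Ioi hα)
  cases i with
  | zero =>
    refine le_trans ?_ (one_le_coth_half hα0)
    simpa using inv_le_one_of_one_le₀ (one_le_pow₀ hM.le)
  | succ i =>
    calc (M ^ 2)⁻¹ * M ^ (2 * (i + 1)) = ((M ^ (2 * i))⁻¹)⁻¹ := by
          rw [mul_add, pow_add]
          field_simp
      _ ≤ α⁻¹ := inv_anti₀ hα0 hα.2
      _ ≤ _ := inv_le_coth_half hα0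

theorem le_tanh_half_of_mem_sliceRange (hM : 1 < M) (hα : α ∈ sliceRange M i) :
    (2 * Real.cosh (1 / 2))⁻¹ * (M ^ (2 * i))⁻¹ ≤ Real.tanh (α / 2) := by
  have hlt : (M ^ (2 * i))⁻¹ < α := sliceRange_subset_Ioi hα
  have := Real.cosh_pos (1 / 2)
  refine le_trans ?_ (mul_min_le_tanh_half (lt_trans (by positivity) hlt))
  gcongr
  exact le_min hlt.le (inv_le_one_of_one_le₀ (one_le_pow₀ hM.le))

theorem propagator_nonneg (hΩ : 0 ≤ Ω) (u v : Pos) : 0 ≤ propagator Ω μ₀ M i u v :=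
  integral_nonneg fun _ => by positivity

theorem measurable_propagator {X : Type*} [MeasurableSpace X] {u v : X → Pos} (hu : Measurable u)
    (hv : Measurable v) : Measurable fun x => propagator Ω μ₀ M i (u x) (v x) := by
  refine (StronglyMeasurable.integral_prod_right (Measurable.stronglyMeasurable ?_)).measurable
  unfold Function.uncurry
  simp only [Real.tanh_eq_sinh_div_cosh]
  fun_prop

/-- The constant in the exponents of the Gaussian bounds of the sliced propagators. -/
noncomputable def decayRate (Ω M : ℝ) : ℝ :=
  Ω / 4 * min (M ^ 2)⁻¹ (2 * Real.cosh (1 / 2))⁻¹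

theorem decayRate_pos (hΩ : 0 < Ω) (hM : 0 < M) : 0 < decayRate Ω M := by
  have := Real.cosh_pos (1 / 2)
  unfold decayRate
  positivity

/-- The Gaussian `exp (- (decayRate Ω M) t ‖x‖²)` on position space; the sliced propagators are
bounded by such Gaussians, with `t = M^{2i}` in the short variable and `t = M^{-2i}` in the
long one. -/
noncomputable def gaussianDecay (Ω M t : ℝ) (x : Pos) : ℝ :=
  Real.exp (-(decayRate Ω M * t) * ‖x‖ ^ 2)

theorem exp_propagator_le (hΩ : 0 < Ω) (hM : 1 < M) (hα : α ∈ sliceRange M i) (u v : Pos) :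
    Real.exp (-(Ω / 4) * (Real.cosh (α / 2) / Real.sinh (α / 2)) * ‖u‖ ^ 2
        - (Ω / 4) * Real.tanh (α / 2) * ‖v‖ ^ 2 - μ₀ ^ 2 / Ω * α) ≤
      gaussianDecay Ω M (M ^ (2 * i)) u * gaussianDecay Ω M (M ^ (2 * i))⁻¹ v := by
  have hα0 : 0 < α := lt_trans (by positivity) (sliceRange_subset_Ioi hα)
  have hshort : decayRate Ω M * M ^ (2 * i) ≤
      Ω / 4 * (Real.cosh (α / 2) / Real.sinh (α / 2)) := by
    rw [decayRate, mul_assoc]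
    gcongr
    refine le_trans ?_ (le_coth_half_of_mem_sliceRange hM hα)
    gcongr
    exact min_le_left _ _
  have hlong : decayRate Ω M * (M ^ (2 * i))⁻¹ ≤ Ω / 4 * Real.tanh (α / 2) := by
    rw [decayRate, mul_assoc]
    gcongr
    refine le_trans ?_ (le_tanh_half_of_mem_sliceRange hM hα)
    gcongr
    exact min_le_right _ _
  have hmass : 0 ≤ μ₀ ^ 2 / Ω * α := by positivity
  rw [gaussianDecay, gaussianDecay, ← Real.exp_add, Real.exp_le_exp]
  linarith [mul_le_mul_of_nonneg_right hshort (sq_nonneg ‖u‖),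
    mul_le_mul_of_nonneg_right hlong (sq_nonneg ‖v‖)]

theorem div_sq_sinh_le (hΩ : 0 ≤ Ω) (hα : 0 < α) :
    Ω / (2 * Real.pi * Real.sinh α) ^ 2 ≤ Ω / (2 * Real.pi) ^ 2 * α ^ (-2 : ℝ) := by
  have hrpow : α ^ (-2 : ℝ) = (α ^ 2)⁻¹ := by
    rw [Real.rpow_neg hα.le]
    norm_cast
  rw [hrpow, ← div_eq_mul_inv, div_div, ← mul_pow]
  gcongr
  exact Real.self_le_sinh_iff.2 hα.le

theorem integrableOn_rpow_neg_two_Ioi (hM : 0 < M) :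
    IntegrableOn (fun α : ℝ => α ^ (-2 : ℝ)) (Set.Ioi (M ^ (2 * i))⁻¹) :=
  integrableOn_Ioi_rpow_of_lt (by norm_num) (by positivity)

theorem integral_rpow_neg_two_sliceRange_le (hM : 0 < M) :
    ∫ α in sliceRange M i, α ^ (-2 : ℝ) ≤ M ^ (2 * i) := by
  have hpos : 0 < (M ^ (2 * i))⁻¹ := by positivity
  calc ∫ α in sliceRange M i, α ^ (-2 : ℝ)
      ≤ ∫ α in Set.Ioi (M ^ (2 * i))⁻¹, α ^ (-2 : ℝ) := by
        refine setIntegral_mono_set (integrableOn_rpow_neg_two_Ioi hM) ?_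
          sliceRange_subset_Ioi.eventuallyLE
        refine (ae_restrict_iff' measurableSet_Ioi).2 (ae_of_all _ fun α hα => ?_)
        exact Real.rpow_nonneg (hpos.trans hα).le _
    _ = M ^ (2 * i) := by
        rw [integral_Ioi_rpow_of_lt (by norm_num) hpos]
        norm_num [Real.rpow_neg_one]

theorem propagator_le (hΩ : 0 < Ω) (hM : 1 < M) (u v : Pos) :
    propagator Ω μ₀ M i u v ≤ Ω / (2 * Real.pi) ^ 2 * M ^ (2 * i) *
      (gaussianDecay Ω M (M ^ (2 * i)) u * gaussianDecay Ω M (M ^ (2 * i))⁻¹ v) := by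
  set E := gaussianDecay Ω M (M ^ (2 * i)) u * gaussianDecay Ω M (M ^ (2 * i))⁻¹ v
  have hM0 : 0 < M := zero_lt_one.trans hM
  have hE : 0 ≤ E := mul_nonneg (Real.exp_nonneg _) (Real.exp_nonneg _)
  calc propagator Ω μ₀ M i u v
      ≤ ∫ α in sliceRange M i, Ω / (2 * Real.pi) ^ 2 * E * α ^ (-2 : ℝ) := by
        refine integral_mono_of_nonneg (ae_of_all _ fun _ => by positivity)
          (((integrableOn_rpow_neg_two_Ioi hM0).mono_set sliceRange_subset_Ioi).const_mul _) ?_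
        refine (ae_restrict_iff' measurableSet_sliceRange).2 (ae_of_all _ fun α hα => ?_)
        have hα0 : 0 < α := lt_trans (by positivity) (sliceRange_subset_Ioi hα)
        exact (mul_le_mul (div_sq_sinh_le hΩ.le hα0) (exp_propagator_le hΩ hM hα u v)
          (Real.exp_nonneg _) (by positivity)).trans_eq (by ring)
    _ = Ω / (2 * Real.pi) ^ 2 * E * ∫ α in sliceRange M i, α ^ (-2 : ℝ) := integral_const_mul _ _
    _ ≤ Ω / (2 * Real.pi) ^ 2 * E * M ^ (2 * i) := by
        gcongr
        exact integral_rpow_neg_two_sliceRange_le hM0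
    _ = _ := by ring

theorem measurable_gaussianDecay (t : ℝ) : Measurable (gaussianDecay Ω M t) := by
  unfold gaussianDecay
  fun_prop

theorem gaussianDecay_nonneg (t : ℝ) (x : Pos) : 0 ≤ gaussianDecay Ω M t x := Real.exp_nonneg _

theorem gaussianDecay_le_one {t : ℝ} (hΩ : 0 < Ω) (hM : 0 < M) (ht : 0 ≤ t) (x : Pos) :
    gaussianDecay Ω M t x ≤ 1 := by
  have := decayRate_pos hΩ hM
  rw [gaussianDecay, Real.exp_le_one_iff, neg_mul, neg_nonpos]
  positivity

theorem integral_gaussianDecay {t : ℝ} (hΩ : 0 < Ω) (hM : 0 < M) (ht : 0 < t) :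
    ∫ x, gaussianDecay Ω M t x = (Real.pi / decayRate Ω M) ^ 2 * t⁻¹ ^ 2 := by
  unfold gaussianDecay
  rw [GaussianFourier.integral_rexp_neg_mul_sq_norm (mul_pos (decayRate_pos hΩ hM) ht),
    finrank_euclideanSpace_fin, ← mul_pow, ← div_eq_mul_inv, div_div, ← Real.rpow_natCast]
  norm_num

theorem integrable_gaussianDecay {t : ℝ} (hΩ : 0 < Ω) (hM : 0 < M) (ht : 0 < t) :
    Integrable (gaussianDecay Ω M t) := by
  have := decayRate_pos hΩ hM
  refine .of_integral_ne_zero ?_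
  rw [integral_gaussianDecay hΩ hM ht]
  positivity

end Propagator

theorem exists_norm_le_of_isVonNBounded {E F : Type*} [NormedAddCommGroup E] [NormedSpace ℝ E]
    [NormedAddCommGroup F] [NormedSpace ℝ F] {𝓕 : Set (SchwartzMap E F)}
    (h𝓕 : Bornology.IsVonNBounded ℝ 𝓕) (k : ℕ) :
    ∃ C, 0 < C ∧ ∀ φ ∈ 𝓕, ∀ x, ‖φ x‖ ≤ C * (1 + ‖x‖) ^ (-k : ℝ) := by
  obtain ⟨r, hr, hseminorm⟩ :=
    ((schwartz_withSeminorms ℝ E F).isVonNBounded_iff_finset_seminorm_bounded.1 h𝓕)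
      (Finset.Iic (k, 0))
  refine ⟨2 ^ k * r, by positivity, fun φ hφ x => ?_⟩
  have hφx := SchwartzMap.one_add_le_sup_seminorm_apply (𝕜 := ℝ) (m := (k, 0)) le_rfl le_rfl φ x
  rw [norm_iteratedFDeriv_zero] at hφx
  have hpos : (0 : ℝ) < 1 + ‖x‖ := by positivity
  rw [Real.rpow_neg hpos.le, Real.rpow_natCast, ← div_eq_mul_inv, le_div_iff₀ (by positivity),
    mul_comm]
  exact hφx.trans (by gcongr; exact (hseminorm φ hφ).le)

section ChangeOfVariables

variable {ι κ E : Type*} [Fintype ι] [Fintype κ]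

theorem integral_prod_pi_pi [MeasureSpace E] [SigmaFinite (volume : Measure E)]
    (g : ι × κ → E → ℝ) :
    ∫ y : ι → κ → E, ∏ v, ∏ a, g (v, a) (y v a) = ∏ p, ∫ x, g p x := by
  rw [Fintype.prod_prod_type,
    integral_fintype_prod_volume_eq_prod fun v (y : κ → E) => ∏ a, g (v, a) (y a)]
  exact Finset.prod_congr rfl fun v _ => integral_fintype_prod_volume_eq_prod fun a => g (v, a)

theorem integrable_prod_pi_pi [MeasureSpace E] [SigmaFinite (volume : Measure E)]
    {g : ι × κ → E → ℝ} (hg : ∀ p, Integrable (g p)) :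
    Integrable fun y : ι → κ → E => ∏ v, ∏ a, g (v, a) (y v a) :=
  .fintype_prod (f := fun v (y : κ → E) => ∏ a, g (v, a) (y a)) fun v =>
    .fintype_prod (f := fun a => g (v, a)) fun a => hg (v, a)

variable [NormedAddCommGroup E]

/-- The `E`-valued linear form with integer coefficients `c` on families of vectors of `E`. -/
def intForm (c : ι × κ → ℤ) (y : ι → κ → E) : E := ∑ j, c j • y j.1 j.2

theorem continuous_intForm (c : ι × κ → ℤ) : Continuous (intForm (E := E) c) := by
  unfold intForm
  fun_prop

variable [NormedSpace ℝ E]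

/-- The linear substitution with integer matrix `A` on families of vectors of `E`. -/
def intSubst (A : Matrix (ι × κ) (ι × κ) ℤ) : (ι → κ → E) →ₗ[ℝ] (ι → κ → E) where
  toFun y v a := intForm (A (v, a)) y
  map_add' y z := by
    ext
    simp [intForm, Finset.sum_add_distrib]
  map_smul' r y := by
    ext
    simp [intForm, Finset.smul_sum, smul_comm r]

variable [FiniteDimensional ℝ E]

theorem det_intSubst [DecidableEq ι] [DecidableEq κ] (A : Matrix (ι × κ) (ι × κ) ℤ) :
    LinearMap.det (intSubst (E := E) A) = ((A.det ^ Module.finrank ℝ E : ℤ) : ℝ) := by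
  let b := Module.finBasis ℝ E
  let e : (ι → κ → E) ≃ₗ[ℝ] ((ι × κ) × Fin (Module.finrank ℝ E) → ℝ) :=
    (LinearEquiv.curry ℝ E ι κ).symm ≪≫ₗ LinearEquiv.piCongrRight (fun _ => b.equivFun) ≪≫ₗ
      (LinearEquiv.curry ℝ ℝ (ι × κ) (Fin (Module.finrank ℝ E))).symm
  have hconj : e.toLinearMap ∘ₗ intSubst A ∘ₗ e.symm.toLinearMap = Matrix.toLin'
      (Matrix.kroneckerMap (· * ·) ((Int.castRingHom ℝ).mapMatrix A) 1) := by
    refine LinearMap.ext fun z => funext fun ⟨⟨v, a⟩, d⟩ => ?_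
    simp only [Matrix.toLin'_apply, Matrix.mulVec, dotProduct, Fintype.sum_prod_type]
    simp [e, intSubst, intForm, Matrix.one_apply, Fintype.sum_prod_type, Finsupp.single_apply]
  rw [← LinearMap.det_conj _ e, hconj, LinearMap.det_toLin', Matrix.det_kronecker,
    ← RingHom.map_det]
  simp

variable [MeasureSpace E] [BorelSpace E] [(volume : Measure E).IsAddHaarMeasure]

theorem map_intSubst_volume [DecidableEq ι] [DecidableEq κ] {A : Matrix (ι × κ) (ι × κ) ℤ}
    (hA : A.det ≠ 0) :
    Measure.map (intSubst (E := E) A) volume =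
      ENNReal.ofReal |(LinearMap.det (intSubst (E := E) A))⁻¹| • volume := by
  have : (volume : Measure (κ → E)).IsAddHaarMeasure := Measure.pi.isAddHaarMeasure fun _ => volume
  have : (volume : Measure (ι → κ → E)).IsAddHaarMeasure :=
    Measure.pi.isAddHaarMeasure fun _ => volume
  refine Measure.map_linearMap_addHaar_eq_smul_addHaar volume ?_
  rw [det_intSubst]
  exact_mod_cast pow_ne_zero _ hA

/-- A nonzero integer determinant is at least `1` in absolute value, so an integer substitution
does not increase the integral. -/
theorem integral_prod_intForm_le_of_det_ne_zero [DecidableEq ι] [DecidableEq κ]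
    {A : Matrix (ι × κ) (ι × κ) ℤ} (hA : A.det ≠ 0) {g : ι × κ → E → ℝ}
    (hg : ∀ p, Integrable (g p)) (hg0 : ∀ p x, 0 ≤ g p x) :
    Integrable (fun y : ι → κ → E => ∏ p, g p (intForm (A p) y)) ∧
      ∫ y : ι → κ → E, ∏ p, g p (intForm (A p) y) ≤ ∏ p, ∫ x, g p x := by
  set F : (ι → κ → E) → ℝ := fun y => ∏ v, ∏ a, g (v, a) (y v a)
  have hcomp : (fun y : ι → κ → E => ∏ p, g p (intForm (A p) y)) = F ∘ intSubst A := by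
    funext y
    simp [F, Fintype.prod_prod_type, intSubst]
  have hmeas : AEMeasurable (intSubst (E := E) A) :=
    (LinearMap.continuous_of_finiteDimensional _).aemeasurable
  have hF : Integrable F (Measure.map (intSubst A) volume) := by
    rw [map_intSubst_volume hA]
    exact (integrable_prod_pi_pi hg).smul_measure ENNReal.ofReal_ne_top
  have hdet : |(LinearMap.det (intSubst (E := E) A))⁻¹| ≤ 1 := by
    rw [abs_inv, det_intSubst]
    exact inv_le_one_of_one_le₀ (by exact_mod_cast Int.one_le_abs (pow_ne_zero _ hA))
  rw [hcomp]
  refine ⟨(integrable_map_measure hF.1 hmeas).1 hF, ?_⟩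
  calc ∫ y, (F ∘ intSubst A) y = ∫ y, F y ∂(Measure.map (intSubst A) volume) :=
        (integral_map hmeas hF.1).symm
    _ = |(LinearMap.det (intSubst (E := E) A))⁻¹| * ∏ p, ∫ x, g p x := by
        rw [map_intSubst_volume hA, integral_smul_measure, integral_prod_pi_pi,
          ENNReal.toReal_ofReal (abs_nonneg _), smul_eq_mul]
    _ ≤ ∏ p, ∫ x, g p x :=
        mul_le_of_le_one_left (Finset.prod_nonneg fun p _ => integral_nonneg (hg0 p)) hdet

theorem integral_prod_intForm_le {P : Type*} [Fintype P] {c : P → ι × κ → ℤ} {b : Finset P}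
    (hcard : b.card = Fintype.card (ι × κ))
    (hli : LinearIndepOn ℝ (fun p j => (c p j : ℝ)) (b : Set P)) {g : P → E → ℝ}
    (hmeas : ∀ p, Measurable (g p)) (hg0 : ∀ p x, 0 ≤ g p x) (hg1 : ∀ p x, g p x ≤ 1)
    (hg : ∀ p ∈ b, Integrable (g p)) :
    Integrable (fun y : ι → κ → E => ∏ p, g p (intForm (c p) y)) ∧
      ∫ y : ι → κ → E, ∏ p, g p (intForm (c p) y) ≤ ∏ p ∈ b, ∫ x, g p x := by
  classical
  let e : ι × κ ≃ b := Fintype.equivOfCardEq (by rw [Fintype.card_coe, hcard])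
  let A : Matrix (ι × κ) (ι × κ) ℤ := .of fun j => c (e j)
  have hA : A.det ≠ 0 := by
    have hunit : IsUnit ((Int.castRingHom ℝ).mapMatrix A) :=
      Matrix.linearIndependent_rows_iff_isUnit.1 (hli.linearIndependent.comp e e.injective)
    rw [Matrix.isUnit_iff_isUnit_det, ← RingHom.map_det, isUnit_iff_ne_zero] at hunit
    exact fun h => hunit (by simp [h])
  have hsubset_prod (y : ι → κ → E) :
      ∏ j, g (e j) (intForm (A j) y) = ∏ p ∈ b, g p (intForm (c p) y) := by
    rw [← Finset.prod_coe_sort b]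
    exact e.prod_comp fun p : b => g p (intForm (c p) y)
  obtain ⟨hint, hle⟩ := integral_prod_intForm_le_of_det_ne_zero hA
    (g := fun j => g (e j)) (fun j => hg _ (e j).2) fun j => hg0 (e j)
  simp only [hsubset_prod] at hint hle
  have hprod_le (y : ι → κ → E) :
      ∏ p, g p (intForm (c p) y) ≤ ∏ p ∈ b, g p (intForm (c p) y) := by
    rw [← Finset.prod_mul_prod_compl b]
    exact mul_le_of_le_one_right (Finset.prod_nonneg fun _ _ => hg0 _ _)
      (Finset.prod_le_one (fun _ _ => hg0 _ _) fun _ _ => hg1 _ _)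
  have hint_all : Integrable (fun y : ι → κ → E => ∏ p, g p (intForm (c p) y)) := by
    refine hint.mono' ?_ (ae_of_all _ fun y => ?_)
    · exact (Finset.measurable_prod _ fun p _ =>
        (hmeas p).comp (continuous_intForm _).measurable).aestronglyMeasurable
    · rw [Real.norm_of_nonneg (Finset.prod_nonneg fun _ _ => hg0 _ _)]
      exact hprod_le y
  refine ⟨hint_all, (integral_mono hint_all hint hprod_le).trans (hle.trans_eq ?_)⟩
  rw [← Finset.prod_coe_sort b]
  exact e.prod_comp fun p : b => ∫ x, g p x

end ChangeOfVariables

section Algebra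

theorem zpow_sum {ι G₀ : Type*} [CommGroupWithZero G₀] {a : G₀} (ha : a ≠ 0) (s : Finset ι)
    (f : ι → ℤ) : a ^ ∑ i ∈ s, f i = ∏ i ∈ s, a ^ f i := by
  classical
  induction s using Finset.induction_on with
  | empty => simp
  | insert i s his ih => rw [Finset.sum_insert his, Finset.prod_insert his, zpow_add₀ ha, ih]

theorem sum_eq_sum_Icc_card {ι : Type*} (s : Finset ι) {μ : ι → ℕ} {k : ℕ}
    (hμ : ∀ l ∈ s, μ l ≤ k) : ∑ l ∈ s, μ l = ∑ i ∈ Finset.Icc 1 k, {l ∈ s | i ≤ μ l}.card := by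
  refine (Finset.sum_congr rfl fun l hl => ?_).trans
    (Finset.sum_card_bipartiteAbove_eq_sum_card_bipartiteBelow fun l i => i ≤ μ l)
  have hfilter : {i ∈ Finset.Icc 1 k | i ≤ μ l} = Finset.Icc 1 (μ l) := by
    ext i
    have := hμ l hl
    simp only [Finset.mem_filter, Finset.mem_Icc]
    omega
  simp [Finset.bipartiteAbove, hfilter]

variable {ι κ K V : Type*} [Field K] [AddCommGroup V] [Module K V]

theorem exists_linearIndepOn_span_le (v : ι → V) (w : ι → ℕ) (t : ℕ) :
    ∃ b ⊆ {i | w i < t}, LinearIndepOn K v b ∧ ∀ s < t,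
      Submodule.span K (v '' {i | w i ≤ s}) ≤ Submodule.span K (v '' (b ∩ {i | w i ≤ s})) := by
  induction t with
  | zero => exact ⟨∅, Set.empty_subset _, linearIndepOn_empty K v, fun _ hs => by simp at hs⟩
  | succ t ih =>
    obtain ⟨b, hb, hli, hspan⟩ := ih
    obtain ⟨b', hb', hbb', hspan', hli'⟩ := exists_linearIndepOn_extension hli
      (t := {i | w i < t + 1}) fun i hi => (hb hi).trans (Nat.lt_succ_self t)
    refine ⟨b', hb', hli', fun s hs => ?_⟩
    rcases Nat.lt_succ_iff_lt_or_eq.1 hs with hst | rfl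
    · exact (hspan s hst).trans
        (Submodule.span_mono (Set.image_mono (Set.inter_subset_inter_left _ hbb')))
    · simp only [Nat.lt_succ_iff] at hspan' hb'
      rwa [Set.inter_eq_left.2 hb', Submodule.span_le]

/-- Greedy choice: the vectors are added in the order of increasing weight. -/
theorem exists_linearIndepOn_card_eq_finrank_span [Finite ι] (v : ι → V) (w : ι → ℕ) :
    ∃ b : Finset ι, LinearIndepOn K v (b : Set ι) ∧
      ∀ s, {i ∈ b | w i ≤ s}.card = Module.finrank K (Submodule.span K (v '' {i | w i ≤ s})) := by
  classical
  have := Fintype.ofFinite ι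
  set t := Finset.univ.sup w
  have hw (i : ι) : w i ≤ t := Finset.le_sup (Finset.mem_univ i)
  obtain ⟨b, -, hli, hspan⟩ := exists_linearIndepOn_span_le (K := K) v w (t + 1)
  refine ⟨b.toFinset, by simpa using hli, fun s => ?_⟩
  have hmin : {i | w i ≤ s} = {i | w i ≤ min s t} := by
    ext i
    simp [hw i]
  have heq : Submodule.span K (v '' (b ∩ {i | w i ≤ s})) =
      Submodule.span K (v '' {i | w i ≤ s}) := by
    refine le_antisymm (Submodule.span_mono (Set.image_mono Set.inter_subset_right)) ?_
    rw [hmin]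
    exact hspan _ (Nat.lt_succ_of_le (min_le_right s t))
  rw [← heq, Set.image_eq_range, finrank_span_eq_card (hli.mono Set.inter_subset_left),
    ← Set.toFinset_card]
  congr 1
  ext i
  simp

variable [Fintype κ]

/-- The common kernel of the linear forms `y ↦ v i ⬝ᵥ y` with `i ∈ s`. -/
def commonKernel (v : ι → κ → K) (s : Set ι) : Submodule K (κ → K) :=
  LinearMap.ker (Matrix.of fun i : s => v i).mulVecLin

theorem mem_commonKernel {v : ι → κ → K} {s : Set ι} {y : κ → K} :
    y ∈ commonKernel v s ↔ ∀ i ∈ s, v i ⬝ᵥ y = 0 := by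
  simp [commonKernel, funext_iff, Matrix.mulVec]

theorem finrank_span_add_finrank_commonKernel [Finite ι] (v : ι → κ → K) (s : Set ι) :
    Module.finrank K (Submodule.span K (v '' s)) + Module.finrank K (commonKernel v s) =
      Fintype.card κ := by
  classical
  have hrow : Set.range (Matrix.of fun i : s => v i).row = v '' s :=
    (Set.image_eq_range v s).symm
  rw [← hrow, ← Matrix.rank_eq_finrank_span_row, Matrix.rank, commonKernel,
    LinearMap.finrank_range_add_finrank_ker, Module.finrank_fintype_fun_eq_card]

end Algebra

namespace Graph

variable {n m : ℕ} {G : Graph n m}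

section Lines

variable {W : Finset (Fin n)} {S : Finset (Fin m)}

theorem eq_of_common_end {l l' : Fin m} {f : Fin n × Fin 4} (hl : G.src l = f ∨ G.tgt l = f)
    (hl' : G.src l' = f ∨ G.tgt l' = f) : l = l' := by
  have hinj (e e' : Fin m ⊕ Fin m) := @G.inj e e'
  simp only [Sum.forall, Sum.elim_inl, Sum.elim_inr] at hinj
  grind

theorem mem_externalFields {f : Fin n × Fin 4} :
    f ∈ G.externalFields W S ↔ f.1 ∈ W ∧ ∀ l ∈ S, G.src l ≠ f ∧ G.tgt l ≠ f := by
  simp [externalFields]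

theorem sum_fields {β : Type*} [AddCommMonoid β]
    (hS : ∀ l ∈ S, (G.src l).1 ∈ W ∧ (G.tgt l).1 ∈ W) (p : Fin n × Fin 4 → β) :
    ∑ f ∈ W ×ˢ Finset.univ, p f =
      ∑ l ∈ S, (p (G.src l) + p (G.tgt l)) + ∑ f ∈ G.externalFields W S, p f := by
  classical
  let ends : Finset (Fin n × Fin 4) := (S.disjSum S).map ⟨Sum.elim G.src G.tgt, G.inj⟩
  have hends : ends ⊆ W ×ˢ Finset.univ := by
    intro f
    simp only [ends, Finset.mem_map, Finset.mem_disjSum, Function.Embedding.coeFn_mk,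
      Finset.mem_product, Finset.mem_univ, and_true]
    rintro ⟨_, ⟨l, hl, rfl⟩ | ⟨l, hl, rfl⟩, rfl⟩
    exacts [(hS l hl).1, (hS l hl).2]
  have hexternal : G.externalFields W S = (W ×ˢ Finset.univ) \ ends := by
    ext f
    simp [mem_externalFields, ends, forall_and]
  rw [hexternal, add_comm, ← Finset.sum_sdiff hends]
  simp [ends, Finset.sum_add_distrib]

theorem two_mul_card_add_card_externalFields
    (hS : ∀ l ∈ S, (G.src l).1 ∈ W ∧ (G.tgt l).1 ∈ W) :
    2 * S.card + (G.externalFields W S).card = 4 * W.card := by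
  have hsum := sum_fields hS fun _ => 1
  simp only [Finset.sum_const, Finset.card_product, Finset.card_univ, Fintype.card_fin,
    smul_eq_mul] at hsum
  omega

theorem two_mul_add_card_externals : 2 * m + G.externals.card = 4 * n := by
  simpa using two_mul_card_add_card_externalFields (G := G) (W := Finset.univ) (S := Finset.univ)
    fun _ _ => ⟨Finset.mem_univ _, Finset.mem_univ _⟩

theorem reachable_src_tgt {l : Fin m} (hl : l ∈ S) :
    (G.lineGraph S).Reachable (G.src l).1 (G.tgt l).1 := by
  by_cases h : (G.src l).1 = (G.tgt l).1
  · rw [h]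
  · exact SimpleGraph.Adj.reachable ⟨h, .inl ⟨l, hl, rfl, rfl⟩⟩

theorem eq_of_reachable {α : Type*} {D : Fin n → α}
    (hD : ∀ l ∈ S, D (G.src l).1 = D (G.tgt l).1) {v w : Fin n}
    (hvw : (G.lineGraph S).Reachable v w) : D v = D w := by
  obtain ⟨p⟩ := hvw
  induction p with
  | nil => rfl
  | cons hadj _ ih =>
    refine Eq.trans ?_ ih
    rcases hadj.2 with ⟨l, hl, rfl, rfl⟩ | ⟨l, hl, rfl, rfl⟩
    exacts [hD l hl, (hD l hl).symm]

theorem exists_subset_le_lineGraph {H : SimpleGraph (Fin n)} [Fintype H.edgeSet]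
    (hH : H ≤ G.lineGraph S) :
    ∃ T ⊆ S, T.card = H.edgeFinset.card ∧ H ≤ G.lineGraph T := by
  classical
  let edge (l : Fin m) : Sym2 (Fin n) := s((G.src l).1, (G.tgt l).1)
  have hsurj : Set.SurjOn edge S H.edgeFinset := by
    rintro ⟨v, w⟩ hvw
    rw [SimpleGraph.coe_edgeFinset] at hvw
    rcases (hH hvw).2 with ⟨l, hl, rfl, rfl⟩ | ⟨l, hl, rfl, rfl⟩
    exacts [⟨l, hl, rfl⟩, ⟨l, hl, Sym2.eq_swap⟩]
  obtain ⟨T, hTS, hinj, himage⟩ := hsurj.exists_subset_injOn_image_eq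
  lift T to Finset (Fin m) using T.toFinite
  norm_cast at hTS himage
  refine ⟨T, hTS, by rw [← himage, Finset.card_image_of_injOn hinj], fun v w hvw => ⟨hvw.ne, ?_⟩⟩
  obtain ⟨l, hl, hlvw⟩ : ∃ l ∈ T, edge l = s(v, w) := by
    rw [← Finset.mem_image, himage, SimpleGraph.mem_edgeFinset]
    exact hvw
  rcases Sym2.eq_iff.1 hlvw with ⟨hv, hw⟩ | ⟨hw, hv⟩
  exacts [.inl ⟨l, hl, hv, hw⟩, .inr ⟨l, hl, hw, hv⟩]

end Lines

section Component

variable {μ : Fin m → ℕ} {i : ℕ}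

theorem mem_highLines {l : Fin m} : l ∈ highLines μ i ↔ i ≤ μ l := by simp [highLines]

theorem Component.mem_vertices {k : G.Component μ i} {v : Fin n} :
    v ∈ k.vertices ↔ (G.lineGraph (highLines μ i)).connectedComponentMk v = k := by
  simp [Component.vertices]

theorem Component.mem_lines {k : G.Component μ i} {l : Fin m} :
    l ∈ k.lines ↔ l ∈ highLines μ i ∧ (G.src l).1 ∈ k.vertices := by
  simp [Component.lines, Component.vertices]

theorem Component.ends_mem {k : G.Component μ i} {l : Fin m} (hl : l ∈ k.lines) :
    (G.src l).1 ∈ k.vertices ∧ (G.tgt l).1 ∈ k.vertices := by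
  rw [Component.mem_lines] at hl
  refine ⟨hl.2, ?_⟩
  rw [Component.mem_vertices, ← Component.mem_vertices.1 hl.2, SimpleGraph.ConnectedComponent.eq]
  exact (reachable_src_tgt hl.1).symm

theorem Component.two_mul_card_lines_add_N (k : G.Component μ i) :
    2 * k.lines.card + k.N = 4 * k.vertices.card :=
  two_mul_card_add_card_externalFields fun _ hl => k.ends_mem hl

theorem Component.le_lineGraph_lines (k : G.Component μ i) :
    k.toSimpleGraph.map (Function.Embedding.subtype _) ≤ G.lineGraph k.lines := by
  rw [SimpleGraph.map_le_iff_le_comap]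
  rintro ⟨v, hv⟩ ⟨w, hw⟩ ⟨hne, hvw⟩
  refine ⟨hne, hvw.imp ?_ ?_⟩ <;> rintro ⟨l, hl, rfl, rfl⟩
  exacts [⟨l, Component.mem_lines.2 ⟨hl, Component.mem_vertices.2 hv⟩, rfl, rfl⟩,
    ⟨l, Component.mem_lines.2 ⟨hl, Component.mem_vertices.2 hw⟩, rfl, rfl⟩]

theorem Component.exists_isSpanningTree (k : G.Component μ i) :
    ∃ T, G.IsSpanningTree k.vertices k.lines T := by
  classical
  obtain ⟨F, hFk, hF⟩ := k.connected_toSimpleGraph.exists_isTree_le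
  obtain ⟨T, hTk, hcard, hFT⟩ := exists_subset_le_lineGraph
    ((SimpleGraph.map_monotone (Function.Embedding.subtype _) hFk).trans k.le_lineGraph_lines)
  refine ⟨T, hTk, fun v hv w hw => ?_, ?_⟩
  · rw [Component.mem_vertices, ← SimpleGraph.ConnectedComponent.mem_supp_iff] at hv hw
    have hvw : F.Reachable ⟨v, hv⟩ ⟨w, hw⟩ := hF.connected ⟨v, hv⟩ ⟨w, hw⟩
    exact (hvw.map (SimpleGraph.Embedding.map _ F).toHom).mono hFT
  · rw [hcard, SimpleGraph.card_edgeFinset_map, hF.card_edgeFinset]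
    exact Fintype.card_of_subtype _ fun _ => Component.mem_vertices

theorem Component.N_pos (hG : G.Connected) (hext : G.externals.Nonempty) (k : G.Component μ i) :
    0 < k.N := by
  by_contra hN
  have hend {f : Fin n × Fin 4} (hf : f.1 ∈ k.vertices) :
      ∃ l ∈ k.lines, G.src l = f ∨ G.tgt l = f := by
    by_contra! hno
    exact hN (Finset.card_pos.2 ⟨f, mem_externalFields.2 ⟨hf, hno⟩⟩)
  have hclosed (l : Fin m) : (G.src l).1 ∈ k.vertices ↔ (G.tgt l).1 ∈ k.vertices := by
    constructor <;> intro hl <;> obtain ⟨l', hl', hend'⟩ := hend hl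
    · rw [eq_of_common_end (.inl rfl) hend']
      exact (k.ends_mem hl').2
    · rw [eq_of_common_end (.inr rfl) hend']
      exact (k.ends_mem hl').1
  obtain ⟨r, hr⟩ := k.nonempty_supp
  obtain ⟨f, hf⟩ := hext
  have hmem : (r ∈ k.vertices) = (f.1 ∈ k.vertices) :=
    eq_of_reachable (fun l _ => propext (hclosed l)) (hG.preconnected r f.1)
  obtain ⟨l, -, hl⟩ := hend (hmem ▸ Component.mem_vertices.2 hr)
  have := (mem_externalFields.1 hf).2 l (Finset.mem_univ l)
  tauto

theorem Component.omega_pos (hG : G.Connected) (hext : G.externals.Nonempty)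
    {k : G.Component μ i} (hk : ¬ k.IsOrientable) : 0 < k.omega := by
  rw [Component.omega, if_neg hk]
  exact_mod_cast k.N_pos hG hext

/-- The number of orientable components of `G^i`. -/
noncomputable def numOrientable (G : Graph n m) (μ : Fin m → ℕ) (i : ℕ) : ℕ :=
  Nat.card {k : G.Component μ i // k.IsOrientable}

open Classical in
theorem sum_card_vertices : ∑ k : G.Component μ i, k.vertices.card = n := by
  have hfiber := Finset.card_eq_sum_card_fiberwise (s := Finset.univ) (t := Finset.univ)
    (f := (G.lineGraph (highLines μ i)).connectedComponentMk) fun _ _ => by simp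
  simpa [Component.vertices] using hfiber.symm

open Classical in
theorem sum_card_lines : ∑ k : G.Component μ i, k.lines.card = (highLines μ i).card := by
  have hfiber := Finset.card_eq_sum_card_fiberwise (s := highLines μ i) (t := Finset.univ)
    (f := fun l => (G.lineGraph (highLines μ i)).connectedComponentMk (G.src l).1)
    fun _ _ => by simp
  rw [hfiber]
  refine Finset.sum_congr rfl fun k _ => congrArg Finset.card ?_
  ext l
  simp [Component.mem_vertices, Component.mem_lines]

open Classical in
theorem sum_omega : ∑ k : G.Component μ i, k.omega =
    4 * n - 2 * (highLines μ i).card - 4 * G.numOrientable μ i := by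
  have homega (k : G.Component μ i) : k.omega =
      4 * (k.vertices.card : ℤ) - 2 * k.lines.card - 4 * (if k.IsOrientable then 1 else 0) := by
    have := k.two_mul_card_lines_add_N
    unfold Component.omega
    split_ifs <;> omega
  have hvertices : ∑ k : G.Component μ i, (k.vertices.card : ℤ) = n := by
    exact_mod_cast sum_card_vertices
  have hlines : ∑ k : G.Component μ i, (k.lines.card : ℤ) = (highLines μ i).card := by
    exact_mod_cast sum_card_lines
  simp only [homega, Finset.sum_sub_distrib, ← Finset.mul_sum, Finset.sum_boole]
  rw [hvertices, hlines, numOrientable, Nat.card_eq_fintype_card, Fintype.card_subtype]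

end Component

section Orientation

/-- The sign of the corner `a` in the vertex constraint `∑ a, (-1)^a x_{v,a} = 0`; it also
describes the orientations that alternate around a vertex. -/
def cornerSign : Fin 4 → ℝ := ![1, -1, 1, -1]

theorem abs_cornerSign (a : Fin 4) : |cornerSign a| = 1 := by
  fin_cases a <;> simp [cornerSign]

theorem cornerSign_ne_zero (a : Fin 4) : cornerSign a ≠ 0 := by
  simp [← abs_pos, abs_cornerSign]

theorem cornerSign_add_one (a : Fin 4) : cornerSign (a + 1) = -cornerSign a := by
  fin_cases a <;> simp [cornerSign]

theorem isAlternating_of_signs {d : Fin n → ℝ} (hd : ∀ v, d v ≠ 0) :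
    IsAlternating fun f => decide (0 < cornerSign f.2 * d f.1) := by
  intro v a
  have hne := mul_ne_zero (cornerSign_ne_zero a) (hd v)
  simp only [cornerSign_add_one, neg_mul, Left.neg_pos_iff]
  rcases hne.lt_or_gt with h | h <;> simp [h, h.le]

variable {μ : Fin m → ℕ} {i : ℕ}

theorem Component.isOrientable_of_signs {k : G.Component μ i} {d : Fin n → ℝ}
    (hd : ∀ l ∈ k.lines, cornerSign (G.src l).2 * d (G.src l).1 +
      cornerSign (G.tgt l).2 * d (G.tgt l).1 = 0)
    (hd0 : ∀ v ∈ k.vertices, d v ≠ 0) : k.IsOrientable := by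
  classical
  obtain ⟨T, hT⟩ := k.exists_isSpanningTree
  let d' (v : Fin n) : ℝ := if v ∈ k.vertices then d v else 1
  have hd' (v : Fin n) : d' v ≠ 0 := by
    by_cases hv : v ∈ k.vertices <;> simp [d', hv, hd0]
  have hclash (l : Fin m) (hl : l ∈ k.lines) :
      ¬ G.Clashing (fun f => decide (0 < cornerSign f.2 * d' f.1)) l := by
    have hsum := hd l hl
    have hsrc := mul_ne_zero (cornerSign_ne_zero (G.src l).2) (hd0 _ (k.ends_mem hl).1)
    rw [Clashing]
    simp only [d', if_pos (k.ends_mem hl).1, if_pos (k.ends_mem hl).2, decide_eq_decide,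
      eq_neg_of_add_eq_zero_right hsum, Left.neg_pos_iff]
    rcases hsrc.lt_or_gt with h | h <;> simp [h, h.le]
  exact ⟨T, hT, _, isAlternating_of_signs hd', fun l hl => hclash l (hT.1 hl), hclash⟩

end Orientation

end Graph

section Positions

variable {n : ℕ}

/-- The integer coefficients of the position `x_f`, constrained by the `δ` function of its vertex,
with respect to the first three positions at each vertex. -/
def posCoeff (f : Fin n × Fin 4) (j : Fin n × Fin 3) : ℤ :=
  if f.1 = j.1 then
    (![![1, 0, 0], ![0, 1, 0], ![0, 0, 1], ![1, -1, 1]] : Fin 4 → Fin 3 → ℤ) f.2 j.2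
  else 0

variable {E : Type*} [NormedAddCommGroup E]

theorem intForm_posCoeff (f : Fin n × Fin 4) (y : Fin n → Fin 3 → E) :
    intForm (posCoeff f) y =
      (![y f.1 0, y f.1 1, y f.1 2, y f.1 0 - y f.1 1 + y f.1 2] : Fin 4 → E) f.2 := by
  obtain ⟨v, a⟩ := f
  rw [intForm, Fintype.sum_prod_type, Fintype.sum_eq_single v fun w hw => by
    simp [posCoeff, hw.symm]]
  fin_cases a <;> simp [posCoeff, Fin.sum_univ_three, sub_eq_add_neg]

theorem eq_zero_of_intForm_posCoeff {y : Fin n → Fin 3 → E}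
    (hy : ∀ f, intForm (posCoeff f) y = 0) : y = 0 := by
  funext v b
  have hcorner := hy (v, b.castSucc)
  rw [intForm_posCoeff] at hcorner
  fin_cases b <;> exact hcorner

theorem sum_cornerSign_mul_intForm_posCoeff (y : Fin n → Fin 3 → ℝ) (v : Fin n) :
    ∑ a, Graph.cornerSign a * intForm (posCoeff (v, a)) y = 0 := by
  simp only [intForm_posCoeff, Fin.sum_univ_four]
  simp only [Graph.cornerSign, Matrix.cons_val]
  ring

/-- The four positions at a vertex satisfy no other relation than the vertex constraint. -/
theorem eq_cornerSign_mul_of_sum_mul_posCoeff {w : Fin n × Fin 4 → ℝ}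
    (hw : ∀ j, ∑ f, w f * posCoeff f j = 0) (v : Fin n) (a : Fin 4) :
    w (v, a) = Graph.cornerSign a * w (v, 0) := by
  have hvertex (b : Fin 3) : ∑ a, w (v, a) * posCoeff (v, a) (v, b) = 0 := by
    rw [← hw (v, b), Fintype.sum_prod_type, Fintype.sum_eq_single v fun u hu => by
      simp [posCoeff, hu]]
  have h0 := hvertex 0
  have h1 := hvertex 1
  have h2 := hvertex 2
  simp only [Fin.sum_univ_four, posCoeff, ↓reduceIte, Matrix.cons_val', Matrix.cons_val_zero,
    Matrix.cons_val_one, Matrix.cons_val, Matrix.cons_val_fin_one, Int.cast_neg, Int.cast_one,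
    Int.cast_zero, mul_one, mul_zero, mul_neg, add_zero, zero_add] at h0 h1 h2
  fin_cases a <;> simp [Graph.cornerSign] <;> linarith

end Positions

namespace Graph

variable {n m : ℕ} {G : Graph n m}

/-- The arguments of the factors of the integrand: the short variable `u_l` and the long variable
`v_l` of each line, in this order, and the external positions. -/
abbrev Form (G : Graph n m) : Type := Fin m ⊕ (Fin m ⊕ {f // f ∈ G.externals})

/-- The integer coefficients of the arguments of the integrand with respect to the first three
positions at each vertex. -/
def formCoeff : G.Form → Fin n × Fin 3 → ℤ
  | .inl l => posCoeff (G.src l) - posCoeff (G.tgt l)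
  | .inr (.inl l) => posCoeff (G.src l) + posCoeff (G.tgt l)
  | .inr (.inr f) => posCoeff f.1

/-- The coefficients `formCoeff` as real vectors. -/
def formVec (p : G.Form) (j : Fin n × Fin 3) : ℝ := formCoeff p j

/-- The greedy order of the integration variables: first the short variables, then the external
positions and the long variables by increasing scale. -/
def formWeight (μ : Fin m → ℕ) : G.Form → ℕ
  | .inl _ => 0
  | .inr (.inl l) => μ l + 1
  | .inr (.inr _) => 1

theorem intForm_formCoeff_short {E : Type*} [NormedAddCommGroup E] (y : Fin n → Fin 3 → E)
    (l : Fin m) : intForm (formCoeff (.inl l : G.Form)) y =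
      intForm (posCoeff (G.src l)) y - intForm (posCoeff (G.tgt l)) y := by
  simp [intForm, formCoeff, sub_smul]

theorem intForm_formCoeff_long {E : Type*} [NormedAddCommGroup E] (y : Fin n → Fin 3 → E)
    (l : Fin m) : intForm (formCoeff (.inr (.inl l) : G.Form)) y =
      intForm (posCoeff (G.src l)) y + intForm (posCoeff (G.tgt l)) y := by
  simp [intForm, formCoeff, add_smul, Finset.sum_add_distrib]

theorem formVec_dotProduct (p : G.Form) (y : Fin n × Fin 3 → ℝ) :
    formVec p ⬝ᵥ y = intForm (formCoeff p) (Function.curry y) := by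
  simp [formVec, intForm, dotProduct]

theorem linearIndependent_formVec_short (hG : G.Connected) (hext : G.externals.Nonempty) :
    LinearIndependent ℝ fun l : Fin m => formVec (.inl l : G.Form) := by
  rw [Fintype.linearIndependent_iff]
  intro c hc
  let w : Fin n × Fin 4 → ℝ := Function.extend (Sum.elim G.src G.tgt) (Sum.elim c (-c)) 0
  have hsrc (l : Fin m) : w (G.src l) = c l := G.inj.extend_apply _ _ (.inl l)
  have htgt (l : Fin m) : w (G.tgt l) = -c l := G.inj.extend_apply _ _ (.inr l)
  have hexternal {f : Fin n × Fin 4} (hf : f ∈ G.externals) : w f = 0 := by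
    have := (mem_externalFields.1 hf).2
    exact Function.extend_apply' _ _ _ (by simpa [forall_and] using this)
  have hrelation (j : Fin n × Fin 3) : ∑ f, w f * posCoeff f j = 0 := by
    rw [← Finset.univ_product_univ, sum_fields (G := G) (S := Finset.univ) (by simp),
      Finset.sum_eq_zero (s := G.externals) fun f hf => by rw [hexternal hf, zero_mul], add_zero]
    refine Eq.trans ?_ (congrFun hc j)
    rw [Finset.sum_apply]
    refine Finset.sum_congr rfl fun l _ => ?_
    simp only [hsrc, htgt, formVec, formCoeff, Pi.smul_apply, Pi.sub_apply, smul_eq_mul]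
    push_cast
    ring
  have hcorner (f : Fin n × Fin 4) : |w f| = |w (f.1, 0)| := by
    rw [← Prod.mk.eta (p := f), eq_cornerSign_mul_of_sum_mul_posCoeff hrelation, abs_mul,
      abs_cornerSign, one_mul]
  obtain ⟨e, he⟩ := hext
  intro l
  have hconst : |w ((G.src l).1, 0)| = |w (e.1, 0)| :=
    eq_of_reachable (D := fun v => |w (v, 0)|)
      (fun l _ => by rw [← hcorner, ← hcorner, hsrc, htgt, abs_neg])
      (hG.preconnected (G.src l).1 e.1)
  rwa [← hcorner, ← hcorner, hsrc, hexternal he, abs_zero, abs_eq_zero] at hconst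

section Incidence

variable {μ : Fin m → ℕ} {i : ℕ}

/-- The signed incidence matrix of `G^i`: an end of a line at the corner `a` of the vertex `v`
contributes `(-1)^a` to the row `v`, so that the rows express the vertex constraints. -/
def signedIncidence (G : Graph n m) (μ : Fin m → ℕ) (i : ℕ) : Matrix (Fin n) (highLines μ i) ℝ :=
  .of fun v l => (if (G.src l).1 = v then cornerSign (G.src l).2 else 0) +
    if (G.tgt l).1 = v then cornerSign (G.tgt l).2 else 0

theorem signedIncidence_transpose_mulVec (d : Fin n → ℝ) (l : highLines μ i) :
    ((G.signedIncidence μ i).transpose.mulVec d) l =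
      cornerSign (G.src l).2 * d (G.src l).1 + cornerSign (G.tgt l).2 * d (G.tgt l).1 := by
  simp [Matrix.mulVec, dotProduct, signedIncidence, add_mul, Finset.sum_add_distrib]

theorem finrank_ker_signedIncidence_transpose_le :
    Module.finrank ℝ (G.signedIncidence μ i).transpose.mulVecLin.ker ≤ G.numOrientable μ i := by
  classical
  let eval : (G.signedIncidence μ i).transpose.mulVecLin.ker →ₗ[ℝ]
      {k : G.Component μ i // k.IsOrientable} → ℝ :=
    (LinearMap.pi fun k => LinearMap.proj (Quot.out k.1)) ∘ₗ Submodule.subtype _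
  have heval : Function.Injective eval := by
    rw [← LinearMap.ker_eq_bot, LinearMap.ker_eq_bot']
    rintro ⟨d, hd⟩ hd0
    have hline (l : Fin m) (hl : l ∈ highLines μ i) :
        cornerSign (G.src l).2 * d (G.src l).1 + cornerSign (G.tgt l).2 * d (G.tgt l).1 = 0 := by
      rw [← signedIncidence_transpose_mulVec d ⟨l, hl⟩]
      exact congrFun hd _
    have hconst {v w : Fin n} (hvw : (G.lineGraph (highLines μ i)).connectedComponentMk v =
        (G.lineGraph (highLines μ i)).connectedComponentMk w) : |d v| = |d w| := by
      refine eq_of_reachable (D := fun v => |d v|) (fun l hl => ?_)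
        (SimpleGraph.ConnectedComponent.exact hvw)
      simpa [abs_mul, abs_cornerSign] using congrArg abs (eq_neg_of_add_eq_zero_left (hline l hl))
    ext v
    by_contra hv
    let k : G.Component μ i := (G.lineGraph (highLines μ i)).connectedComponentMk v
    have hk : k.IsOrientable :=
      k.isOrientable_of_signs (fun l hl => hline l (Component.mem_lines.1 hl).1) fun w hw hw0 =>
        hv (abs_eq_zero.1 (by simpa [hw0] using (hconst (Component.mem_vertices.1 hw)).symm))
    have hout : d (Quot.out k) = 0 := congrFun hd0 ⟨k, hk⟩
    have hv_eq : |d (Quot.out k)| = |d v| := hconst (Quot.out_eq k)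
    exact hv (abs_eq_zero.1 (by rw [← hv_eq, hout, abs_zero]))
  refine (LinearMap.finrank_le_finrank_of_injective heval).trans_eq ?_
  rw [Module.finrank_fintype_fun_eq_card, numOrientable, Nat.card_eq_fintype_card]

theorem add_finrank_ker_signedIncidence_le :
    n + Module.finrank ℝ (G.signedIncidence μ i).mulVecLin.ker ≤
      (highLines μ i).card + G.numOrientable μ i := by
  have hrank := Matrix.rank_transpose (G.signedIncidence μ i)
  have hker := LinearMap.finrank_range_add_finrank_ker (G.signedIncidence μ i).mulVecLin
  have hker' :=
    LinearMap.finrank_range_add_finrank_ker (G.signedIncidence μ i).transpose.mulVecLin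
  have := finrank_ker_signedIncidence_transpose_le (G := G) (μ := μ) (i := i)
  simp only [Matrix.rank] at hrank
  simp only [Module.finrank_fintype_fun_eq_card, Fintype.card_coe, Fintype.card_fin] at hker hker'
  omega

theorem signedIncidence_mulVec {p : Fin n × Fin 4 → ℝ}
    (hline : ∀ l, p (G.src l) = p (G.tgt l))
    (hexternal : ∀ f ∈ G.externalFields Finset.univ (highLines μ i), p f = 0) (v : Fin n) :
    (G.signedIncidence μ i).mulVec (fun l : highLines μ i => p (G.src l)) v =
      ∑ a, cornerSign a * p (v, a) := by
  let q (f : Fin n × Fin 4) : ℝ := (if f.1 = v then cornerSign f.2 else 0) * p f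
  have hq : ∑ a, cornerSign a * p (v, a) = ∑ f, q f := by
    rw [Fintype.sum_prod_type, Fintype.sum_eq_single v fun w hw => by simp [q, hw]]
    simp [q]
  have hq_external : ∑ f ∈ G.externalFields Finset.univ (highLines μ i), q f = 0 :=
    Finset.sum_eq_zero fun f hf => by simp only [q, hexternal f hf, mul_zero]
  rw [hq, ← Finset.univ_product_univ, sum_fields (G := G) (S := highLines μ i) (by simp),
    hq_external, add_zero, Matrix.mulVec, dotProduct, ← Finset.sum_coe_sort (highLines μ i)]
  refine Finset.sum_congr rfl fun l _ => ?_
  simp only [q, signedIncidence, Matrix.of_apply, ← hline]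
  ring

theorem intForm_posCoeff_of_mem_commonKernel (hi : 1 ≤ i) {y : Fin n × Fin 3 → ℝ}
    (hy : y ∈ commonKernel formVec {p : G.Form | formWeight μ p ≤ i}) :
    (∀ l, intForm (posCoeff (G.src l)) (Function.curry y) =
        intForm (posCoeff (G.tgt l)) (Function.curry y)) ∧
      ∀ f ∈ G.externalFields Finset.univ (highLines μ i),
        intForm (posCoeff f) (Function.curry y) = 0 := by
  simp only [mem_commonKernel, formVec_dotProduct, Set.mem_ofPred_eq] at hy
  have hshort (l : Fin m) := sub_eq_zero.1
    ((intForm_formCoeff_short _ l).symm.trans (hy (.inl l) (Nat.zero_le i)))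
  refine ⟨hshort, fun f hf => ?_⟩
  by_cases hfext : f ∈ G.externals
  · exact hy (.inr (.inr ⟨f, hfext⟩)) hi
  obtain ⟨l, hl⟩ : ∃ l, G.src l = f ∨ G.tgt l = f := by
    simpa [mem_externalFields, or_iff_not_imp_left] using hfext
  have hlow : formWeight μ (.inr (.inl l) : G.Form) ≤ i := by
    have := (mem_externalFields.1 hf).2 l
    rw [mem_highLines] at this
    exact Nat.lt_of_not_le fun h => by tauto
  have hlong := (intForm_formCoeff_long _ l).symm.trans (hy _ hlow)
  have := hshort l
  rcases hl with rfl | rfl <;> linarith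

theorem finrank_commonKernel_formVec_le (hi : 1 ≤ i) :
    Module.finrank ℝ (commonKernel formVec {p : G.Form | formWeight μ p ≤ i}) ≤
      Module.finrank ℝ (G.signedIncidence μ i).mulVecLin.ker := by
  let value : (Fin n × Fin 3 → ℝ) →ₗ[ℝ] (highLines μ i → ℝ) :=
    (Matrix.of fun l : highLines μ i => fun j => (posCoeff (G.src l) j : ℝ)).mulVecLin
  have hvalue (y : Fin n × Fin 3 → ℝ) :
      value y = fun l : highLines μ i => intForm (posCoeff (G.src l)) (Function.curry y) := by
    ext l
    simp [value, intForm, Matrix.mulVec, dotProduct]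
  have hmaps : ∀ y ∈ commonKernel formVec {p : G.Form | formWeight μ p ≤ i},
      value y ∈ (G.signedIncidence μ i).mulVecLin.ker := by
    intro y hy
    obtain ⟨hline, hexternal⟩ := intForm_posCoeff_of_mem_commonKernel hi hy
    rw [LinearMap.mem_ker, Matrix.mulVecLin_apply, hvalue]
    funext v
    rw [signedIncidence_mulVec hline hexternal, sum_cornerSign_mul_intForm_posCoeff]
    rfl
  refine LinearMap.finrank_le_finrank_of_injective (f := value.restrict hmaps) ?_
  rw [← LinearMap.ker_eq_bot, LinearMap.ker_eq_bot']
  rintro ⟨y, hy⟩ hy0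
  obtain ⟨hline, hexternal⟩ := intForm_posCoeff_of_mem_commonKernel hi hy
  have hsrc (l : Fin m) (hl : l ∈ highLines μ i) :
      intForm (posCoeff (G.src l)) (Function.curry y) = 0 := by
    have := congrFun (congrArg Subtype.val hy0) ⟨l, hl⟩
    rwa [LinearMap.coe_restrict_apply, hvalue] at this
  have hzero : Function.curry y = 0 := eq_zero_of_intForm_posCoeff fun f => by
    by_cases hf : f ∈ G.externalFields Finset.univ (highLines μ i)
    · exact hexternal f hf
    obtain ⟨l, hl, hlf⟩ : ∃ l ∈ highLines μ i, G.src l = f ∨ G.tgt l = f := by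
      simpa [mem_externalFields, or_iff_not_imp_left] using hf
    rcases hlf with rfl | rfl
    exacts [hsrc l hl, hline l ▸ hsrc l hl]
  exact Subtype.ext (funext fun j => congrFun (congrFun hzero j.1) j.2)

end Incidence

section Basis

theorem finrank_span_range_formVec :
    Module.finrank ℝ (Submodule.span ℝ (Set.range (formVec (G := G)))) = 3 * n := by
  have hall : {p : G.Form | formWeight 0 p ≤ 1} = Set.univ := by
    ext p
    rcases p with l | l | f <;> simp [formWeight]
  have hspan := finrank_span_add_finrank_commonKernel formVec {p : G.Form | formWeight 0 p ≤ 1}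
  have hkernel := finrank_commonKernel_formVec_le (G := G) (μ := 0) le_rfl
  have hle := Submodule.finrank_le (G.signedIncidence 0 1).mulVecLin.ker
  have hnone : (highLines (0 : Fin m → ℕ) 1).card = 0 := by simp [highLines]
  rw [Module.finrank_fintype_fun_eq_card, Fintype.card_coe, hnone] at hle
  rw [hall, Set.image_univ] at hspan
  rw [hall] at hkernel
  simp only [Fintype.card_prod, Fintype.card_fin] at hspan
  omega

variable {μ : Fin m → ℕ}

open Classical in
theorem add_card_long_le {b : Finset G.Form} {i : ℕ} (hi : 1 ≤ i) (hcard : b.card = 3 * n)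
    (hspan : {p ∈ b | formWeight μ p ≤ i}.card =
      Module.finrank ℝ (Submodule.span ℝ (formVec '' {p : G.Form | formWeight μ p ≤ i}))) :
    n + {l ∈ highLines μ i | .inr (.inl l) ∈ b}.card ≤
      (highLines μ i).card + G.numOrientable μ i := by
  have hlong : {l ∈ highLines μ i | .inr (.inl l) ∈ b}.card ≤
      {p ∈ b | ¬ formWeight μ p ≤ i}.card := by
    refine Finset.card_le_card_of_injOn (fun l => .inr (.inl l)) (fun l hl => ?_)
      (Sum.inr_injective.comp Sum.inl_injective).injOn
    simpa [formWeight, mem_highLines, Nat.lt_succ_iff, and_comm] using hl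
  have hsplit := Finset.card_filter_add_card_filter_not (s := b) fun p => formWeight μ p ≤ i
  have hrank := finrank_span_add_finrank_commonKernel formVec {p : G.Form | formWeight μ p ≤ i}
  have hkernel := finrank_commonKernel_formVec_le (G := G) (μ := μ) hi
  have hincidence := add_finrank_ker_signedIncidence_le (G := G) (μ := μ) (i := i)
  simp only [Fintype.card_prod, Fintype.card_fin] at hrank
  omega

open Classical in
theorem exists_basis_formVec (hG : G.Connected) (hext : G.externals.Nonempty) (μ : Fin m → ℕ) :
    ∃ b : Finset G.Form, b.card = 3 * n ∧ LinearIndepOn ℝ formVec (b : Set G.Form) ∧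
      (∀ l, .inl l ∈ b) ∧ ∀ i, 1 ≤ i →
        n + {l ∈ highLines μ i | .inr (.inl l) ∈ b}.card ≤
          (highLines μ i).card + G.numOrientable μ i := by
  obtain ⟨b, hli, hspan⟩ :=
    exists_linearIndepOn_card_eq_finrank_span (K := ℝ) (formVec (G := G)) (formWeight μ)
  have hcard : b.card = 3 * n := by
    have hall := hspan (Finset.univ.sup (formWeight (G := G) μ))
    have hle (p : G.Form) : formWeight μ p ≤ Finset.univ.sup (formWeight (G := G) μ) :=
      Finset.le_sup (Finset.mem_univ p)
    rwa [Finset.filter_true_of_mem fun p _ => hle p, (Set.eq_univ_of_forall hle :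
      {p | formWeight μ p ≤ _} = _), Set.image_univ, finrank_span_range_formVec] at hall
  refine ⟨b, hcard, hli, fun l => ?_, fun i hi => add_card_long_le hi hcard (hspan i)⟩
  have hshort : {p : G.Form | formWeight μ p ≤ 0} = Set.range .inl := by
    ext p
    rcases p with l | l | f <;> simp [formWeight]
  have hcard_short : {p ∈ b | formWeight μ p ≤ 0}.card = m := by
    rw [hspan, hshort, ← Set.range_comp]
    exact (finrank_span_eq_card (linearIndependent_formVec_short hG hext)).trans
      (Fintype.card_fin m)
  have hsubset : {p ∈ b | formWeight μ p ≤ 0} ⊆ Finset.univ.map .inl := fun p hp => by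
    have hp0 : p ∈ {p : G.Form | formWeight μ p ≤ 0} := (Finset.mem_filter.1 hp).2
    rw [hshort] at hp0
    simpa using hp0
  have heq := Finset.eq_of_subset_of_card_le hsubset (by rw [hcard_short]; simp)
  have hmem : .inl l ∈ Finset.univ.map (.inl : Fin m ↪ G.Form) := by simp
  rw [← heq] at hmem
  exact (Finset.mem_filter.1 hmem).1

end Basis

end Graph

namespace Graph

variable {n m : ℕ} {G : Graph n m} {Ω M : ℝ} {μ : Fin m → ℕ}

section Integrand

theorem norm_vertexPhase (θ : ℝ) (x : Fin 4 → Pos) : ‖vertexPhase θ x‖ = 1 := by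
  rw [vertexPhase, mul_comm, Complex.norm_exp_ofReal_mul_I]

theorem continuous_vertexPhase (θ : ℝ) : Continuous (vertexPhase θ) := by
  unfold vertexPhase symp
  refine Complex.continuous_exp.comp (continuous_const.mul (Complex.continuous_ofReal.comp ?_))
  refine continuous_finsetSum _ fun a _ => continuous_finsetSum _ fun b _ => ?_
  split_ifs <;> fun_prop

theorem positions_eq_intForm (y : Fin n → Fin 3 → Pos) (f : Fin n × Fin 4) :
    positions y f.1 f.2 = intForm (posCoeff f) y :=
  (intForm_posCoeff f y).symm

theorem continuous_positions (v : Fin n) (a : Fin 4) :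
    Continuous fun y : Fin n → Fin 3 → Pos => positions y v a := by
  simp only [positions_eq_intForm _ (v, a)]
  exact continuous_intForm _

theorem measurable_integrand (θ Ω μ₀ M : ℝ) (μ : Fin m → ℕ)
    (φ : Fin n × Fin 4 → SchwartzMap Pos ℂ) :
    Measurable fun y : Fin n → Fin 3 → Pos => G.integrand θ Ω μ₀ M μ φ (positions y) := by
  have hposition (f : Fin n × Fin 4) :
      Measurable fun y : Fin n → Fin 3 → Pos => positions y f.1 f.2 :=
    (continuous_positions f.1 f.2).measurable
  refine (Measurable.mul ?_ ?_).mul ?_ <;> refine Finset.measurable_prod _ fun j _ => ?_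
  · exact (continuous_vertexPhase θ).measurable.comp
      (measurable_pi_lambda _ fun a => hposition (j, a))
  · exact Complex.measurable_ofReal.comp (measurable_propagator
      ((hposition (G.src j)).sub (hposition (G.tgt j)))
      ((hposition (G.src j)).add (hposition (G.tgt j))))
  · exact (φ j).continuous.measurable.comp (hposition j)

/-- The decay of the factors of the integrand in their arguments, normalized to be at most `1`. -/
noncomputable def formDecay (Ω M : ℝ) (μ : Fin m → ℕ) : G.Form → Pos → ℝ
  | .inl l => gaussianDecay Ω M (M ^ (2 * μ l))
  | .inr (.inl l) => gaussianDecay Ω M (M ^ (2 * μ l))⁻¹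
  | .inr (.inr _) => fun x => (1 + ‖x‖) ^ (-5 : ℝ)

theorem norm_integrand_le {θ μ₀ C : ℝ} (hΩ : 0 < Ω) (hM : 1 < M)
    {φ : Fin n × Fin 4 → SchwartzMap Pos ℂ}
    (hφ : ∀ f ∈ G.externals, ∀ x, ‖φ f x‖ ≤ C * (1 + ‖x‖) ^ (-5 : ℝ)) (y : Fin n → Fin 3 → Pos) :
    ‖G.integrand θ Ω μ₀ M μ φ (positions y)‖ ≤
      (Ω / (2 * Real.pi) ^ 2) ^ m * C ^ G.externals.card * M ^ (2 * ∑ l, μ l) *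
        ∏ p : G.Form, formDecay Ω M μ p (intForm (formCoeff p) y) := by
  have hpropagators : ∏ l, ‖(propagator Ω μ₀ M (μ l)
      (positions y (G.src l).1 (G.src l).2 - positions y (G.tgt l).1 (G.tgt l).2)
      (positions y (G.src l).1 (G.src l).2 + positions y (G.tgt l).1 (G.tgt l).2) : ℂ)‖ ≤
      ∏ l, Ω / (2 * Real.pi) ^ 2 * M ^ (2 * μ l) *
        (formDecay Ω M μ (.inl l : G.Form) (intForm (formCoeff (.inl l : G.Form)) y) *
          formDecay Ω M μ (.inr (.inl l) : G.Form)
            (intForm (formCoeff (.inr (.inl l) : G.Form)) y)) := by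
    refine Finset.prod_le_prod (fun l _ => norm_nonneg _) fun l _ => ?_
    rw [Complex.norm_real, Real.norm_of_nonneg (propagator_nonneg hΩ.le _ _),
      intForm_formCoeff_short, intForm_formCoeff_long, ← positions_eq_intForm,
      ← positions_eq_intForm]
    exact propagator_le hΩ hM _ _
  have hexternals : ∏ f ∈ G.externals, ‖φ f (positions y f.1 f.2)‖ ≤
      ∏ f : G.externals, C * formDecay Ω M μ (.inr (.inr f) : G.Form)
        (intForm (formCoeff (.inr (.inr f) : G.Form)) y) := by
    rw [← Finset.prod_coe_sort]
    refine Finset.prod_le_prod (fun f _ => norm_nonneg _) fun f _ => ?_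
    rw [positions_eq_intForm]
    exact hφ f.1 f.2 _
  rw [integrand, norm_mul, norm_mul, norm_prod, norm_prod, norm_prod,
    Finset.prod_congr rfl fun v _ => norm_vertexPhase θ _, Finset.prod_const_one, one_mul]
  refine (mul_le_mul hpropagators hexternals (Finset.prod_nonneg fun f _ => norm_nonneg _)
    ((Finset.prod_nonneg fun l _ => norm_nonneg _).trans hpropagators)).trans_eq ?_
  simp only [Fintype.prod_sum_type, Finset.prod_mul_distrib, Finset.prod_const, Finset.card_univ,
    Fintype.card_fin, Fintype.card_coe, Finset.mul_sum, Finset.prod_pow_eq_pow_sum]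
  ring

end Integrand

section FormDecay

theorem measurable_formDecay (p : G.Form) : Measurable (formDecay Ω M μ p) := by
  rcases p with l | l | _
  · exact measurable_gaussianDecay _
  · exact measurable_gaussianDecay _
  · unfold formDecay
    fun_prop

theorem formDecay_nonneg (p : G.Form) (x : Pos) : 0 ≤ formDecay Ω M μ p x := by
  rcases p with l | l | _
  · exact gaussianDecay_nonneg _ x
  · exact gaussianDecay_nonneg _ x
  · exact Real.rpow_nonneg (by positivity) _

theorem formDecay_le_one (hΩ : 0 < Ω) (hM : 0 < M) (p : G.Form) (x : Pos) :
    formDecay Ω M μ p x ≤ 1 := by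
  rcases p with l | l | _
  · exact gaussianDecay_le_one hΩ hM (by positivity) x
  · exact gaussianDecay_le_one hΩ hM (by positivity) x
  · exact Real.rpow_le_one_of_one_le_of_nonpos (by simp) (by norm_num)

theorem integrable_formDecay (hΩ : 0 < Ω) (hM : 0 < M) (p : G.Form) :
    Integrable (formDecay Ω M μ p) := by
  rcases p with l | l | _
  · exact integrable_gaussianDecay hΩ hM (by positivity)
  · exact integrable_gaussianDecay hΩ hM (by positivity)
  · exact integrable_one_add_norm (by rw [finrank_euclideanSpace_fin]; norm_num)

/-- The exponent of `M` in the integral of `formDecay` over position space. -/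
def scaleExp (μ : Fin m → ℕ) : G.Form → ℤ
  | .inl l => -(4 * μ l)
  | .inr (.inl l) => 4 * μ l
  | .inr (.inr _) => 0

theorem exists_integral_formDecay_le (hΩ : 0 < Ω) (hM : 0 < M) :
    ∃ J : ℝ, 0 < J ∧ ∀ (n m : ℕ) (G : Graph n m) (μ : Fin m → ℕ) (p : G.Form),
      ∫ x, formDecay Ω M μ p x ≤ J * M ^ scaleExp μ p := by
  have hrate := decayRate_pos hΩ hM
  refine ⟨max ((Real.pi / decayRate Ω M) ^ 2) (∫ x : Pos, (1 + ‖x‖) ^ (-5 : ℝ)),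
    lt_max_of_lt_left (by positivity), fun n m G μ p => ?_⟩
  rcases p with l | l | f <;> simp only [formDecay, scaleExp]
  · rw [integral_gaussianDecay hΩ hM (by positivity), zpow_neg]
    refine mul_le_mul (le_max_left _ _) (le_of_eq ?_) (by positivity) (by positivity)
    rw [inv_pow, ← pow_mul]
    norm_cast
    ring_nf
  · rw [integral_gaussianDecay hΩ hM (by positivity), inv_inv, ← pow_mul]
    refine mul_le_mul (le_max_left _ _) (le_of_eq ?_) (by positivity) (by positivity)
    norm_cast
    ring_nf
  · simp

theorem integral_prod_formDecay_le (hΩ : 0 < Ω) (hM : 0 < M) {b : Finset G.Form}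
    (hcard : b.card = 3 * n) (hli : LinearIndepOn ℝ formVec (b : Set G.Form)) {J : ℝ}
    (hJ : ∀ p : G.Form, ∫ x, formDecay Ω M μ p x ≤ J * M ^ scaleExp μ p) :
    Integrable (fun y : Fin n → Fin 3 → Pos =>
        ∏ p : G.Form, formDecay Ω M μ p (intForm (formCoeff p) y)) ∧
      ∫ y : Fin n → Fin 3 → Pos, ∏ p : G.Form, formDecay Ω M μ p (intForm (formCoeff p) y) ≤
        J ^ (3 * n) * M ^ ∑ p ∈ b, scaleExp μ p := by
  obtain ⟨hint, hle⟩ := integral_prod_intForm_le (by simp [hcard, mul_comm]) hli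
    measurable_formDecay formDecay_nonneg (formDecay_le_one (μ := μ) hΩ hM)
    fun p _ => integrable_formDecay hΩ hM p
  refine ⟨hint, hle.trans ?_⟩
  rw [zpow_sum hM.ne', ← hcard, ← Finset.prod_const, ← Finset.prod_mul_distrib]
  exact Finset.prod_le_prod (fun p _ => integral_nonneg (formDecay_nonneg p)) fun p _ => hJ p

end FormDecay

section Amplitude

theorem pow_mul_pow_card_externals_le {C C' : ℝ} (hC : 0 ≤ C) (hC' : 0 ≤ C') :
    C ^ m * C' ^ G.externals.card ≤ ((1 + C) ^ 2 * (1 + C') ^ 4) ^ n := by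
  have := G.two_mul_add_card_externals
  have hpow {c : ℝ} {a b : ℕ} (hc : 0 ≤ c) (hab : a ≤ b) : c ^ a ≤ (1 + c) ^ b :=
    (pow_le_pow_left₀ hc (by linarith) a).trans (pow_le_pow_right₀ (by linarith) hab)
  rw [mul_pow, ← pow_mul, ← pow_mul]
  exact mul_le_mul (hpow hC (by omega)) (hpow hC' (by omega)) (by positivity) (by positivity)

theorem norm_amplitude_le {θ μ₀ C B : ℝ} (hΩ : 0 < Ω) (hM : 1 < M) (hC : 0 ≤ C)
    {φ : Fin n × Fin 4 → SchwartzMap Pos ℂ}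
    (hφ : ∀ f ∈ G.externals, ∀ x, ‖φ f x‖ ≤ C * (1 + ‖x‖) ^ (-5 : ℝ))
    (hint : Integrable fun y : Fin n → Fin 3 → Pos =>
      ∏ p : G.Form, formDecay Ω M μ p (intForm (formCoeff p) y))
    (hB : ∫ y : Fin n → Fin 3 → Pos,
      ∏ p : G.Form, formDecay Ω M μ p (intForm (formCoeff p) y) ≤ B) :
    Integrable (fun y => G.integrand θ Ω μ₀ M μ φ (positions y)) ∧
      ‖G.amplitude θ Ω μ₀ M μ φ‖ ≤
        ((1 + Ω / (2 * Real.pi) ^ 2) ^ 2 * (1 + C) ^ 4) ^ n * M ^ (2 * ∑ l, μ l) * B := by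
  have hprefactor := G.pow_mul_pow_card_externals_le
    (show 0 ≤ Ω / (2 * Real.pi) ^ 2 by positivity) hC
  have hbound := ae_of_all volume (norm_integrand_le (θ := θ) (μ₀ := μ₀) (μ := μ) hΩ hM hφ)
  refine ⟨(hint.const_mul _).mono' (measurable_integrand θ Ω μ₀ M μ φ).aestronglyMeasurable hbound,
    (norm_integral_le_of_norm_le (hint.const_mul _) hbound).trans ?_⟩
  rw [integral_const_mul]
  refine mul_le_mul (by gcongr) hB (integral_nonneg fun y => ?_) (by positivity)
  exact Finset.prod_nonneg fun p _ => formDecay_nonneg p _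

end Amplitude

section PowerCounting

open Classical in
theorem sum_scaleExp {b : Finset G.Form} (hshort : ∀ l, .inl l ∈ b) :
    ∑ p ∈ b, scaleExp μ p =
      4 * ∑ l with .inr (.inl l) ∈ b, (μ l : ℤ) - 4 * ∑ l, (μ l : ℤ) := by
  rw [← Fintype.sum_ite_mem, Fintype.sum_sum_type, Fintype.sum_sum_type]
  simp only [hshort, ↓reduceIte, scaleExp, Finset.sum_neg_distrib, ite_self,
    Finset.sum_const_zero, add_zero, Finset.sum_filter, Finset.mul_sum, mul_ite, mul_zero]
  ring

open Classical in
theorem two_mul_sum_add_sum_scaleExp_le {b : Finset G.Form} (hshort : ∀ l, .inl l ∈ b)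
    (hlong : ∀ i, 1 ≤ i → n + {l ∈ highLines μ i | .inr (.inl l) ∈ b}.card ≤
      (highLines μ i).card + G.numOrientable μ i) :
    2 * ∑ l, (μ l : ℤ) + ∑ p ∈ b, scaleExp μ p ≤
      ∑ i ∈ Finset.Icc 1 (Finset.univ.sup μ), ∑ k : G.Component μ i, -k.omega := by
  have hmax (l : Fin m) : μ l ≤ Finset.univ.sup μ := Finset.le_sup (Finset.mem_univ l)
  have hall : ∑ l, (μ l : ℤ) =
      ∑ i ∈ Finset.Icc 1 (Finset.univ.sup μ), ((highLines μ i).card : ℤ) := by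
    exact_mod_cast sum_eq_sum_Icc_card Finset.univ fun l _ => hmax l
  have hchosen : ∑ l with .inr (.inl l) ∈ b, (μ l : ℤ) =
      ∑ i ∈ Finset.Icc 1 (Finset.univ.sup μ),
        ({l ∈ highLines μ i | .inr (.inl l) ∈ b}.card : ℤ) := by
    simp only [highLines, Finset.filter_comm (fun l => _ ≤ μ l)]
    exact_mod_cast sum_eq_sum_Icc_card _ fun l _ => hmax l
  rw [sum_scaleExp hshort, hall, hchosen]
  simp only [Finset.mul_sum, ← Finset.sum_sub_distrib, ← Finset.sum_add_distrib]
  refine Finset.sum_le_sum fun i hi => ?_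
  have := hlong i (Finset.mem_Icc.1 hi).1
  rw [Finset.sum_neg_distrib, sum_omega]
  omega

open Classical in
theorem pow_mul_zpow_le_powerCounting (hM : 1 < M) {b : Finset G.Form} (hshort : ∀ l, .inl l ∈ b)
    (hlong : ∀ i, 1 ≤ i → n + {l ∈ highLines μ i | .inr (.inl l) ∈ b}.card ≤
      (highLines μ i).card + G.numOrientable μ i) :
    M ^ (2 * ∑ l, μ l) * M ^ ∑ p ∈ b, scaleExp μ p ≤ G.powerCounting M μ := by
  have hM0 : M ≠ 0 := (zero_lt_one.trans hM).ne'
  simp only [powerCounting, ← zpow_sum hM0]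
  rw [← zpow_natCast, ← zpow_add₀ hM0]
  refine zpow_le_zpow_right₀ hM.le ?_
  exact_mod_cast two_mul_sum_add_sum_scaleExp_le hshort hlong

end PowerCounting

end Graph

end NCPhi

theorem mainTheorem3 (θ Ω μ₀ M : ℝ) (hθ : θ ≠ 0) (hΩ : 0 < Ω) (hM : 1 < M)
    (𝓕 : Set (SchwartzMap NCPhi.Pos ℂ)) (h𝓕 : Bornology.IsVonNBounded ℝ 𝓕) :
    ∃ K : ℝ, 0 < K ∧
      ∀ (n m : ℕ) (G : NCPhi.Graph n m), G.Connected → G.externals.Nonempty →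
      ∀ μ : Fin m → ℕ,
        (∀ φ : Fin n × Fin 4 → SchwartzMap NCPhi.Pos ℂ, (∀ f ∈ G.externals, φ f ∈ 𝓕) →
          MeasureTheory.Integrable (fun y : Fin n → Fin 3 → NCPhi.Pos =>
            G.integrand θ Ω μ₀ M μ φ (NCPhi.Graph.positions y)) ∧
          ‖G.amplitude θ Ω μ₀ M μ φ‖ ≤ K ^ n * G.powerCounting M μ) ∧
        (∀ (i : ℕ) (k : G.Component μ i), ¬ k.IsOrientable → 0 < k.omega) := by
  have hM0 : 0 < M := zero_lt_one.trans hM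
  obtain ⟨C, hC, hdecay⟩ := NCPhi.exists_norm_le_of_isVonNBounded h𝓕 5
  obtain ⟨J, hJ, hintegral⟩ := NCPhi.Graph.exists_integral_formDecay_le hΩ hM0
  refine ⟨(1 + Ω / (2 * Real.pi) ^ 2) ^ 2 * (1 + C) ^ 4 * J ^ 3, by positivity,
    fun n m G hG hext μ => ⟨fun φ hφ => ?_, fun i k => k.omega_pos hG hext⟩⟩
  obtain ⟨b, hcard, hli, hshort, hlong⟩ := NCPhi.Graph.exists_basis_formVec hG hext μ
  obtain ⟨hint, hle⟩ := NCPhi.Graph.integral_prod_formDecay_le hΩ hM0 hcard hli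
    (hintegral n m G μ)
  obtain ⟨hintegrable, hamplitude⟩ := NCPhi.Graph.norm_amplitude_le (θ := θ) (μ₀ := μ₀) hΩ hM hC.le
    (fun f hf => mod_cast hdecay _ (hφ f hf)) hint hle
  refine ⟨hintegrable, hamplitude.trans ?_⟩
  calc
    _ = ((1 + Ω / (2 * Real.pi) ^ 2) ^ 2 * (1 + C) ^ 4 * J ^ 3) ^ n *
        (M ^ (2 * ∑ l, μ l) * M ^ ∑ p ∈ b, NCPhi.Graph.scaleExp μ p) := by
      rw [mul_pow _ (J ^ 3), pow_mul J]
      ring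
    _ ≤ _ := by
      gcongr
      exact NCPhi.Graph.pow_mul_zpow_le_powerCounting hM hshort hlong
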